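/- A well partial order (wpo) is a partial order with no infinite antichain and no infinite strictly decreasing sequence. A linearisation of a partial order is a linear order on the same underlying set that extends it. For a wpo $P$ let $o(P)$, the maximal order type of $P$, be the greatest ordinal that is the order type of a linearisation of $P$ (it exists, by de Jongh and Parikh). For partial orders $P$ and $Q$ the lexicographic product $P\cdot Q$ is the set $P\times Q$ ordered by $$(p_0,q_0)<(p_1,q_1)\iff q_0<_Q q_1\ \text{ or }\ (q_0=q_1\text{ and }p_0<_P p_1);$$ it is a wpo whenever $P$ and $Q$ are. Let $\otimes$ denote the Hessenberg (natural) product of ordinals, obtained by multiplying Cantor normal forms as if they were polynomials, the exponents being combined by the Hessenberg (natural) sum, which adds Cantor normal forms as if they were polynomials; $+$ and $\cdot$ between ordinals are the ordinary ordinal sum and product. **Theorem (Vialard).** Let $P$ and $Q$ be wpos, and let $k$ be the (necessarily finite) number of maximal elements of $Q$. Write $o(Q)=\delta+m$, where $\delta$ is $0$ or a limit ordinal and $m$ is a natural number; this is always possible, and $m\ge k$. Then $$o(P\cdot Q)=o(P)\cdot[\delta+(m-k)]+o(P)\otimes k.$$ In particular, if $k=0$ (equivalently, if $o(Q)$ is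 $0$ or a limit ordinal), then $o(P\cdot Q)=o(P)\cdot o(Q)$. -/

import Mathlib

universe u

/-- A linearisation of a partial order `P`, given by its strict relation `r`: a linear order on the
same underlying set that extends the order of `P`. -/
structure IsLinearisation (P : Type u) [PartialOrder P] (r : P → P → Prop) : Prop where
  isStrictTotalOrder : IsStrictTotalOrder P r
  extends_lt : ∀ x y : P, x < y → r x y

/-- `O(P)`: the set of ordinals that are the order type of a linearisation of `P`. -/
def linearisationTypes (P : Type u) [PartialOrder P] : Set Ordinal.{u} :=
  {α | ∃ r : P → P → Prop, IsLinearisation P r ∧ ∃ _ : IsWellOrder P r, Ordinal.type r = α}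

/-- All order types of linearisations of `P` are bounded, so that their supremum is a genuine one. -/
theorem bddAbove_linearisationTypes (P : Type u) [PartialOrder P] :
    BddAbove (linearisationTypes P) := by
  refine ⟨(Order.succ (Cardinal.mk P)).ord, ?_⟩
  rintro α ⟨r, -, hr, rfl⟩
  refine (Cardinal.lt_ord.2 ?_).le
  rw [Ordinal.card_type]
  exact Order.lt_succ _

/-- `o(P)`: the maximal order type of `P`. -/
noncomputable def maximalOrderType (P : Type u) [PartialOrder P] : Ordinal.{u} :=
  sSup (linearisationTypes P)

/-- The lexicographic product `P · Q` of `P` along `Q`: pairs are compared first by their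
`Q`-component and then by their `P`-component. (Mathlib's lexicographic order on pairs compares the
first component first, so a pair is written here with its `Q`-component first.) -/
abbrev LexProduct (P Q : Type u) : Type u := Q ×ₗ P

theorem wellQuasiOrderedLE_lexProduct (P Q : Type u) [PartialOrder P] [PartialOrder Q]
    [WellQuasiOrderedLE P] [WellQuasiOrderedLE Q] : WellQuasiOrderedLE (LexProduct P Q) :=
  (Prod.Lex.toLex_mono (α := Q) (β := P)).wellQuasiOrderedLE_of_wellQuasiOrderedLE_of_surjective
    toLex.surjective

/-- A well partial order has only finitely many maximal elements. -/
theorem finite_setOf_isMax (Q : Type u) [PartialOrder Q] [WellQuasiOrderedLE Q] :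
    {q : Q | IsMax q}.Finite :=
  WellQuasiOrderedLE.finite_of_isAntichain fun _ hx _ _ hne hxy => hne (hx.eq_of_le hxy)

/-- Hessenberg sum: the coefficients of the Cantor normal forms (which are finite ordinals) are
added exponent by exponent. -/
noncomputable def hessenbergAdd (α β : Ordinal.{u}) : Ordinal.{u} :=
  Ordinal.CNF.eval Ordinal.omega0
    (Ordinal.CNF.coeff Ordinal.omega0 α + Ordinal.CNF.coeff Ordinal.omega0 β)

/-- Hessenberg product: the Cantor normal forms are multiplied as polynomials, that is, it is the
Hessenberg sum of all `ω ^ (α_i ⊕ β_j) * (m_i * n_j)`, where `ω ^ α_i * m_i` and `ω ^ β_j * n_j` run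
through the terms of the Cantor normal forms of the factors. -/
noncomputable def hessenbergMul (α β : Ordinal.{u}) : Ordinal.{u} :=
  ((Ordinal.CNF Ordinal.omega0 α ×ˢ Ordinal.CNF Ordinal.omega0 β).map fun t =>
    Ordinal.omega0 ^ hessenbergAdd t.1.1 t.2.1 * (t.1.2 * t.2.2)).foldr hessenbergAdd 0

/-! Everything is computed through the stature, the rank of the tree of bad sequences, which for the
whole order is its maximal order type (`maximalOrderType_eq_stature`). The stature is defined by
recursion on subsets and obeys two estimates. A union has stature at most the natural sum
(`stature_union_le`); if nothing in B lies below an element of A, a set containing both has stature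
at least o(A) + o(B) (`stature_add_le`).

Let N be the set of non-maximal elements of Q. Then o(Q) = o(N) + k, so o(N) = δ + (m - k)
(`stature_not_isMax_add`). For the lower bound, put P·N before the k incomparable copies of P over
the maximal elements; these contribute o(P)·o(N) and o(P) ⊗ k.

For the upper bound write o(P) = ω^e·n + r with r < ω^e and cut P into a lower part of stature ω^e·n
and a remainder of stature r. A remainder over a non-maximal element lies below the lower part over
a larger element, so it adds nothing; only k remainders count. This gives ω^e·n·o(Q) + r ⊗ k
(`stature_lexProd_univ_le`), which is at most the lower bound. -/

open Ordinal Order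

/-! ### Upper bounds for the natural sum -/

/-- The natural sum, defined as the least strictly monotone binary operation on ordinals. -/
noncomputable def natAdd (a b : Ordinal.{u}) : Ordinal.{u} :=
  max (⨆ x : Set.Iio a, succ (natAdd x.1 b)) (⨆ x : Set.Iio b, succ (natAdd a x.1))
termination_by (a, b)
decreasing_by all_goals first
  | exact Prod.Lex.left _ _ x.2
  | exact Prod.Lex.right _ x.2

theorem natAdd_le_iff {a b c : Ordinal.{u}} :
    natAdd a b ≤ c ↔ (∀ a' < a, natAdd a' b < c) ∧ ∀ b' < b, natAdd a b' < c := by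
  rw [natAdd]
  simp [Ordinal.iSup_le_iff]

theorem natAdd_lt_natAdd_left {a a' : Ordinal.{u}} (h : a' < a) (b : Ordinal.{u}) :
    natAdd a' b < natAdd a b :=
  (natAdd_le_iff.1 le_rfl).1 a' h

theorem natAdd_lt_natAdd_right (a : Ordinal.{u}) {b b' : Ordinal.{u}} (h : b' < b) :
    natAdd a b' < natAdd a b :=
  (natAdd_le_iff.1 le_rfl).2 b' h

theorem natAdd_le_natAdd {a a' b b' : Ordinal.{u}} (ha : a' ≤ a) (hb : b' ≤ b) :
    natAdd a' b' ≤ natAdd a b := by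
  have h₁ : natAdd a' b' ≤ natAdd a b' := by
    rcases ha.eq_or_lt with rfl | h
    exacts [le_rfl, (natAdd_lt_natAdd_left h _).le]
  have h₂ : natAdd a b' ≤ natAdd a b := by
    rcases hb.eq_or_lt with rfl | h
    exacts [le_rfl, (natAdd_lt_natAdd_right _ h).le]
  exact h₁.trans h₂

theorem natAdd_natCast_le (b : Ordinal.{u}) (n : ℕ) : natAdd b n ≤ b + n := by
  induction b using WellFoundedLT.induction generalizing n with
  | ind b ihb =>
  induction n using Nat.strong_induction_on with
  | h n ihn =>
  refine natAdd_le_iff.2 ⟨fun b' hb' => (ihb b' hb' n).trans_lt ?_, fun c hc => ?_⟩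
  · exact lt_of_not_ge fun h => hb'.not_ge ((Ordinal.add_le_add_iff_right n).1 h)
  · obtain ⟨m, rfl⟩ := Ordinal.lt_omega0.1 (hc.trans (Ordinal.natCast_lt_omega0 n))
    exact (ihn m (by exact_mod_cast hc)).trans_lt (by simpa using hc)

/-- Lowering an argument either lowers its quotient by w, and then the sum of remainders stays below
w by `hp`, or keeps the quotient and lowers the remainder. The right-hand side drops strictly in
both cases. -/
theorem natAdd_le_div_mod {w : Ordinal.{u}} (hw : w ≠ 0)
    (hp : ∀ x < w, ∀ y < w, natAdd x y < w) (x y : Ordinal.{u}) :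
    natAdd x y ≤ w * natAdd (x / w) (y / w) + natAdd (x % w) (y % w) := by
  have key : ∀ {x' x : Ordinal.{u}}, x' < x →
      x' / w < x / w ∨ x' / w = x / w ∧ x' % w < x % w := by
    intro x' x h
    rcases (Ordinal.div_le_left h.le w).lt_or_eq with h' | h'
    · exact Or.inl h'
    · refine Or.inr ⟨h', ?_⟩
      rw [← Ordinal.div_add_mod x w, ← Ordinal.div_add_mod x' w, h'] at h
      simpa using h
  have step : ∀ {c c' r r' : Ordinal.{u}}, c' < c → r' < w → w * c' + r' < w * c + r := by
    intro c c' r r' hc hr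
    calc w * c' + r' < w * c' + w := by simpa using hr
      _ = w * succ c' := (Ordinal.mul_succ _ _).symm
      _ ≤ w * c := by gcongr; exact succ_le_of_lt hc
      _ ≤ _ := le_self_add
  induction x using WellFoundedLT.induction generalizing y with
  | ind x ihx =>
  induction y using WellFoundedLT.induction with
  | ind y ihy =>
  have hm := fun z : Ordinal.{u} => Ordinal.mod_lt z hw
  refine natAdd_le_iff.2 ⟨fun x' hx' => (ihx x' hx' y).trans_lt ?_,
    fun y' hy' => (ihy y' hy').trans_lt ?_⟩
  · rcases key hx' with h | ⟨h, h'⟩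
    · exact step (natAdd_lt_natAdd_left h _) (hp _ (hm _) _ (hm _))
    · rw [h]
      simpa using natAdd_lt_natAdd_left h' _
  · rcases key hy' with h | ⟨h, h'⟩
    · exact step (natAdd_lt_natAdd_right _ h) (hp _ (hm _) _ (hm _))
    · rw [h]
      simpa using natAdd_lt_natAdd_right _ h'

theorem natAdd_lt_omega0_opow (e : Ordinal.{u}) :
    ∀ x < ω ^ e, ∀ y < ω ^ e, natAdd x y < ω ^ e := by
  induction e using Ordinal.limitRecOn with
  | zero =>
    intro x hx y hy
    simp only [opow_zero, Order.lt_one_iff] at *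
    subst hx hy
    simpa using (natAdd_le_iff (a := 0) (b := 0) (c := 0)).2 (by simp)
  | add_one e ih =>
    intro x hx y hy
    have hw : ω ^ e ≠ 0 := (opow_pos _ omega0_pos).ne'
    refine (natAdd_le_div_mod hw ih x y).trans_lt ?_
    have hx' : x / ω ^ e < ω := by rwa [← Ordinal.lt_mul_iff_div_lt hw, ← opow_add_one]
    have hy' : y / ω ^ e < ω := by rwa [← Ordinal.lt_mul_iff_div_lt hw, ← opow_add_one]
    obtain ⟨m, hm⟩ := lt_omega0.1 hx'
    obtain ⟨n, hn⟩ := lt_omega0.1 hy'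
    refine opow_mul_add_lt_opow ?_ ?_ (lt_add_one e)
    · rw [hm, hn]
      refine (natAdd_natCast_le _ n).trans_lt ?_
      exact_mod_cast natCast_lt_omega0 (m + n)
    · exact ih _ (mod_lt _ hw) _ (mod_lt _ hw)
  | limit e he ih =>
    intro x hx y hy
    rw [lt_opow_of_isSuccLimit omega0_ne_zero he] at hx hy
    obtain ⟨a, ha, hx⟩ := hx
    obtain ⟨b, hb, hy⟩ := hy
    have hab := max_lt ha hb
    refine (ih _ hab x (hx.trans_le ?_) y (hy.trans_le ?_)).trans_le ?_ <;>
    refine opow_le_opow_right omega0_pos ?_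
    exacts [le_max_left _ _, le_max_right _ _, hab.le]

theorem natAdd_mul_add_le (e : Ordinal.{u}) {b r s : Ordinal.{u}} (n : ℕ) (hr : r < ω ^ e)
    (hs : s < ω ^ e) : natAdd (ω ^ e * b + r) (ω ^ e * n + s) ≤ ω ^ e * (b + n) + natAdd r s := by
  have hw : ω ^ e ≠ 0 := (opow_pos _ omega0_pos).ne'
  refine (natAdd_le_div_mod hw (natAdd_lt_omega0_opow e) _ _).trans ?_
  simp only [Ordinal.mul_add_div _ hw, Ordinal.div_eq_zero_of_lt hr,
    Ordinal.div_eq_zero_of_lt hs, mul_add_mod_self, mod_eq_of_lt hr, mod_eq_of_lt hs, add_zero]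
  gcongr
  exact natAdd_natCast_le _ _

theorem natAdd_mul_add_lt (e : Ordinal.{u}) {b r s : Ordinal.{u}} (n : ℕ) (hr : r < ω ^ e)
    (hs : s < ω ^ e) : natAdd (ω ^ e * b + r) (ω ^ e * n + s) < ω ^ e * (b + n + 1) := by
  refine (natAdd_mul_add_le e n hr hs).trans_lt ?_
  rw [mul_add_one]
  simpa using natAdd_lt_omega0_opow e _ hr _ hs

theorem natAdd_mul_le_add (e : Ordinal.{u}) {b s : Ordinal.{u}} (hs : s < ω ^ e) :
    natAdd (ω ^ e * b) s ≤ ω ^ e * b + s := by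
  have h := natAdd_mul_add_le e (b := b) 0 (opow_pos e omega0_pos) hs
  have h0 : natAdd 0 s ≤ s := by
    induction s using WellFoundedLT.induction with
    | ind s ih =>
    refine natAdd_le_iff.2 ⟨by simp, fun t ht => (ih t ht (ht.trans hs) ?_).trans_lt ht⟩
    exact natAdd_mul_add_le e (b := b) 0 (opow_pos e omega0_pos) (ht.trans hs)
  simp only [Nat.cast_zero, mul_zero, add_zero, zero_add] at h
  exact h.trans (by gcongr)

/-! ### Hessenberg product with a natural number -/

theorem hessenbergAdd_zero_right (a : Ordinal.{u}) : hessenbergAdd a 0 = a := by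
  simp [hessenbergAdd]

theorem hessenbergAdd_opow_mul {e x y : Ordinal.{u}} (hx : x < ω) (hy : y < ω ^ e) :
    hessenbergAdd (ω ^ e * x) y = ω ^ e * x + y := by
  rcases eq_or_ne x 0 with rfl | hx0
  · simp [hessenbergAdd]
  have h := CNF.coeff_opow_mul_add one_lt_omega0 hx0 hx (opow_pos e omega0_pos)
  rw [add_zero, CNF.coeff_zero_right, add_zero] at h
  rw [hessenbergAdd, h, CNF.eval_single_add', CNF.eval_coeff]
  intro e' he'
  by_contra! hle
  exact Finsupp.mem_support_iff.1 he'
    (CNF.coeff_eq_zero_of_lt (hy.trans_le (opow_le_opow_right omega0_pos hle)))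

theorem hessenbergMul_zero_left (a : Ordinal.{u}) : hessenbergMul 0 a = 0 := by
  simp [hessenbergMul]

theorem hessenbergMul_zero_right (a : Ordinal.{u}) : hessenbergMul a 0 = 0 := by
  have h : ∀ l : List (Ordinal.{u} × Ordinal.{u}),
      l ×ˢ ([] : List (Ordinal.{u} × Ordinal.{u})) = [] := fun l => List.product_nil l
  simp [hessenbergMul, h]

/-- The hypothesis `h` is provisional: `hessenbergMul_natCast_lt` derives it by an induction on the
Cantor normal form that uses this very formula. -/
theorem hessenbergMul_opow_mul_add_of_lt {e x y : Ordinal.{u}} (k : ℕ) (hx0 : x ≠ 0) (hx : x < ω)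
    (hy : y < ω ^ e) (h : hessenbergMul y k < ω ^ e) :
    hessenbergMul (ω ^ e * x + y) k = ω ^ e * (x * k) + hessenbergMul y k := by
  rcases eq_or_ne k 0 with rfl | hk
  · simp [hessenbergMul_zero_right]
  have hxk : x * k < ω := by
    obtain ⟨n, rfl⟩ := lt_omega0.1 hx
    exact_mod_cast natCast_lt_omega0 (n * k)
  have hcons : ∀ (t : Ordinal.{u} × Ordinal.{u}) (l : List (Ordinal.{u} × Ordinal.{u})),
      (t :: l) ×ˢ [((0 : Ordinal.{u}), (k : Ordinal.{u}))] =
        (t, (0, (k : Ordinal.{u}))) :: (l ×ˢ [((0 : Ordinal.{u}), (k : Ordinal.{u}))]) :=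
    fun t l => List.product_cons t l _
  have hk' : CNF ω (k : Ordinal.{u}) = [(0, (k : Ordinal.{u}))] :=
    CNF.of_lt (by exact_mod_cast hk) (natCast_lt_omega0 k)
  rw [← hessenbergAdd_opow_mul hxk h, hessenbergMul, hessenbergMul,
    CNF.opow_mul_add one_lt_omega0 hx0 hx hy, hk', hcons, List.map_cons, List.foldr_cons,
    hessenbergAdd_zero_right]

theorem cnf_induction {p : Ordinal.{u} → Prop} (zero : p 0)
    (step : ∀ (e : Ordinal.{u}) (n : ℕ) (r : Ordinal.{u}), n ≠ 0 → r < ω ^ e → p r →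
      p (ω ^ e * n + r)) (a : Ordinal.{u}) : p a := by
  induction a using CNF.rec ω with
  | H0 => exact zero
  | H a ha ih =>
    obtain ⟨n, hn⟩ := lt_omega0.1 (div_opow_log_lt a one_lt_omega0)
    rw [← div_add_mod a (ω ^ log ω a), hn]
    refine step _ n _ ?_ (mod_lt _ (opow_pos _ omega0_pos).ne') ih
    rintro rfl
    exact (div_opow_log_pos ω ha).ne' (by simpa using hn)

theorem hessenbergMul_natCast_lt {a : Ordinal.{u}} (k : ℕ) :
    ∀ {e : Ordinal.{u}}, a < ω ^ e → hessenbergMul a k < ω ^ e := by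
  induction a using cnf_induction with
  | zero => simp [hessenbergMul_zero_left]
  | step l n r hn hr ih =>
    intro e he
    rw [hessenbergMul_opow_mul_add_of_lt k (by exact_mod_cast hn) (natCast_lt_omega0 n) hr (ih hr)]
    refine opow_mul_add_lt_opow ?_ (ih hr) ?_
    · exact_mod_cast natCast_lt_omega0 (n * k)
    · rw [← opow_lt_opow_iff_right one_lt_omega0]
      refine lt_of_le_of_lt ?_ he
      refine le_trans ?_ le_self_add
      exact Ordinal.le_mul_left _ (by exact_mod_cast Nat.pos_of_ne_zero hn)

theorem hessenbergMul_opow_mul_add {e y : Ordinal.{u}} {n : ℕ} (k : ℕ) (hn : n ≠ 0)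
    (hy : y < ω ^ e) :
    hessenbergMul (ω ^ e * n + y) k = ω ^ e * (n * k) + hessenbergMul y k :=
  hessenbergMul_opow_mul_add_of_lt k (by exact_mod_cast hn) (natCast_lt_omega0 n) hy
    (hessenbergMul_natCast_lt k hy)

/-- The only link between the recursive natural sum and Cantor normal forms; the upper bounds on
stature need just this direction. -/
theorem natAdd_hessenbergMul_le (a : Ordinal.{u}) (k : ℕ) :
    natAdd (hessenbergMul a k) a ≤ hessenbergMul a (k + 1 : ℕ) := by
  induction a using cnf_induction with
  | zero => simpa [hessenbergMul_zero_left] using natAdd_natCast_le 0 0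
  | step e n r hn hr ih =>
    rw [hessenbergMul_opow_mul_add _ hn hr, hessenbergMul_opow_mul_add _ hn hr]
    refine (natAdd_mul_add_le e n (hessenbergMul_natCast_lt k hr) hr).trans ?_
    rw [Nat.cast_add_one, mul_add_one (n : Ordinal)]
    gcongr
    simpa using ih

/-! ### Stature of subsets of a well partial order -/

section Stature

variable {P : Type u} [PartialOrder P]

/-- The elements of `S` that are not above `x`. -/
def notAbove (S : Set P) (x : P) : Set P := {y ∈ S | ¬ x ≤ y}

theorem notAbove_subset (S : Set P) (x : P) : notAbove S x ⊆ S := fun _ h => h.1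

theorem notAbove_mono {S T : Set P} (h : S ⊆ T) (x : P) : notAbove S x ⊆ notAbove T x :=
  fun _ hy => ⟨h hy.1, hy.2⟩

/-- `D` is obtained from `S` by removing all elements above some element of `S`. -/
def IsNotAbove (D S : Set P) : Prop := ∃ x ∈ S, D = notAbove S x

variable [WellQuasiOrderedLE P]

/-- The elements chosen along an infinite descent form a bad sequence, since each later one survives
the removal of everything above the earlier ones. -/
instance isWellFounded_isNotAbove : IsWellFounded (Set P) IsNotAbove := by
  refine ⟨wellFounded_iff_isEmpty_descending_chain.2 ⟨fun ⟨D, hD⟩ => ?_⟩⟩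
  choose x hx hDx using hD
  have hanti : Antitone D := antitone_nat_of_succ_le fun n => by
    rw [hDx n]
    exact notAbove_subset _ _
  obtain ⟨m, n, hmn, hle⟩ := wellQuasiOrdered_le x
  have h : x n ∈ D (m + 1) := hanti hmn (hx n)
  rw [hDx m] at h
  exact h.2 hle

/-- The stature of a subset of a well partial order: the rank of the tree of its bad sequences. -/
noncomputable def stature (S : Set P) : Ordinal.{u} := IsWellFounded.rank IsNotAbove S

theorem stature_notAbove_lt {S : Set P} {x : P} (hx : x ∈ S) : stature (notAbove S x) < stature S :=
  IsWellFounded.rank_lt_of_rel ⟨x, hx, rfl⟩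

theorem stature_le_iff {S : Set P} {c : Ordinal.{u}} :
    stature S ≤ c ↔ ∀ x ∈ S, stature (notAbove S x) < c := by
  refine ⟨fun h x hx => (stature_notAbove_lt hx).trans_le h, fun h => ?_⟩
  rw [stature, IsWellFounded.rank_eq, Ordinal.iSup_le_iff]
  rintro ⟨_, x, hx, rfl⟩
  exact succ_le_of_lt (h x hx)

theorem lt_stature_iff {S : Set P} {c : Ordinal.{u}} :
    c < stature S ↔ ∃ x ∈ S, c ≤ stature (notAbove S x) := by
  rw [← not_le, stature_le_iff]
  push Not
  rfl

theorem notAbove_induction {p : Set P → Prop} (S : Set P)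
    (ih : ∀ S, (∀ x ∈ S, p (notAbove S x)) → p S) : p S :=
  IsWellFounded.induction IsNotAbove S fun S h => ih S fun x hx => h _ ⟨x, hx, rfl⟩

theorem stature_le_of_map {R : Type u} [PartialOrder R] [WellQuasiOrderedLE R] (f : P → R)
    {S : Set P} : ∀ {T : Set R}, Set.MapsTo f S T →
      (∀ x ∈ S, ∀ y ∈ S, f x ≤ f y → x ≤ y) → stature S ≤ stature T := by
  induction S using notAbove_induction with
  | ih S ih =>
  intro T hf hle
  refine stature_le_iff.2 fun x hx => lt_of_le_of_lt ?_ (stature_notAbove_lt (hf hx))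
  exact ih x hx (fun y hy => ⟨hf hy.1, fun h => hy.2 (hle x hx y hy.1 h)⟩)
    fun y hy z hz => hle y hy.1 z hz.1

theorem stature_mono {S T : Set P} (h : S ⊆ T) : stature S ≤ stature T :=
  stature_le_of_map id h fun _ _ _ _ => id

theorem stature_eq_zero_iff {S : Set P} : stature S = 0 ↔ S = ∅ := by
  rw [← nonpos_iff_eq_zero, stature_le_iff]
  simp [Set.eq_empty_iff_forall_notMem]

/-- Removing the elements above x acts on both pieces and strictly lowers the stature of a piece
containing x, while the natural sum is strictly monotone in each argument. -/
theorem stature_union_le (A B : Set P) : stature (A ∪ B) ≤ natAdd (stature A) (stature B) := by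
  suffices h : ∀ S A B : Set P, S = A ∪ B → stature S ≤ natAdd (stature A) (stature B) from
    h _ A B rfl
  intro S
  induction S using notAbove_induction with
  | ih S ih =>
  rintro A B rfl
  refine stature_le_iff.2 fun x hx => ?_
  refine (ih x hx (notAbove A x) (notAbove B x) ?_).trans_lt ?_
  · ext y
    simp only [notAbove, Set.mem_union, Set.mem_ofPred_eq]
    tauto
  · rcases hx with hx | hx
    · exact (natAdd_le_natAdd le_rfl (stature_mono (notAbove_subset B x))).trans_lt
        (natAdd_lt_natAdd_left (stature_notAbove_lt hx) _)
    · exact (natAdd_le_natAdd (stature_mono (notAbove_subset A x)) le_rfl).trans_lt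
        (natAdd_lt_natAdd_right _ (stature_notAbove_lt hx))

/-- Removing what lies above an element of B leaves A intact, so bad sequences may exhaust B first
and still have all of A left. -/
theorem stature_add_le {A B S : Set P} (hA : A ⊆ S) (hB : B ⊆ S)
    (hAB : ∀ a ∈ A, ∀ b ∈ B, ¬ b ≤ a) : stature A + stature B ≤ stature S := by
  induction B using notAbove_induction generalizing S with
  | ih B ih =>
  rcases B.eq_empty_or_nonempty with rfl | hne
  · rw [stature_eq_zero_iff.2 rfl, add_zero]
    exact stature_mono hA
  by_contra! hlt
  have hlt' : stature S - stature A < stature B :=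
    (Ordinal.sub_lt_of_le (stature_mono hA)).2 hlt
  obtain ⟨y, hy, hle⟩ := lt_stature_iff.1 hlt'
  have h₁ := ih y hy (S := notAbove S y) (fun a ha => ⟨hA ha, hAB a ha y hy⟩)
    (notAbove_mono hB y) fun a ha b hb => hAB a ha b hb.1
  have h₂ := Ordinal.sub_le.1 hle
  exact (stature_notAbove_lt (hB hy)).not_ge (h₂.trans h₁)

theorem exists_isLower_stature_eq {S : Set P} {c : Ordinal.{u}} (hc : c ≤ stature S) :
    ∃ A ⊆ S, (∀ x ∈ A, ∀ y ∈ S, y ≤ x → y ∈ A) ∧ stature A = c := by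
  induction S using notAbove_induction with
  | ih S ih =>
  rcases hc.eq_or_lt with rfl | hlt
  · exact ⟨S, subset_rfl, fun _ _ y hy _ => hy, rfl⟩
  obtain ⟨x, hx, hle⟩ := lt_stature_iff.1 hlt
  obtain ⟨A, hAS, hA, hAc⟩ := ih x hx hle
  refine ⟨A, hAS.trans (notAbove_subset S x), fun a ha y hy hya => ?_, hAc⟩
  exact hA a ha y ⟨hy, fun h => (hAS ha).2 (h.trans hya)⟩ hya

/-- A set of stature `ω ^ e * b + r` with `r ≤ ω ^ e` splits along its order into a part of stature
`ω ^ e * b` and a part of stature `r`. -/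
theorem exists_split {S : Set P} {e b r : Ordinal.{u}} (hr : r ≤ ω ^ e)
    (hS : stature S = ω ^ e * b + r) :
    ∃ A ⊆ S, (∀ x ∈ A, ∀ y ∈ S, y ≤ x → y ∈ A) ∧ stature A = ω ^ e * b ∧
      stature (S \ A) = r := by
  obtain ⟨A, hAS, hA, hAb⟩ := exists_isLower_stature_eq (S := S) (c := ω ^ e * b)
    (hS ▸ le_self_add)
  refine ⟨A, hAS, hA, hAb, le_antisymm ?_ ?_⟩
  · have h := stature_add_le hAS Set.sdiff_subset (B := S \ A)
      fun a ha b hb hba => hb.2 (hA a ha b hb.1 hba)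
    rw [hAb, hS] at h
    simpa using h
  -- A complement of stature below r has stature below ω^e, where the natural sum with a multiple of
  -- ω^e is no larger than the ordinary sum.
  · by_contra! hlt
    have h := stature_union_le A (S \ A)
    rw [Set.union_sdiff_cancel hAS, hS, hAb] at h
    have h' := h.trans (natAdd_mul_le_add e (hlt.trans_le hr))
    exact hlt.not_ge (by simpa using h')

end Stature

/-! ### The stature is attained by a linearisation -/

section Linearisation

variable {P : Type u} [PartialOrder P]

/-- There is a transfinite sequence of length `a` in `S` none of whose terms lies below an earlier
one. -/
def HasBadSeq (S : Set P) (a : Ordinal.{u}) : Prop :=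
  ∃ f : a.ToType → P, (∀ i, f i ∈ S) ∧ ∀ i j, i < j → ¬ f j ≤ f i

theorem HasBadSeq.of_isWellOrder {S : Set P} {a : Ordinal.{u}} {A : Type u} {r : A → A → Prop}
    [IsWellOrder A r] (ha : a ≤ type r) (f : A → P) (hf : ∀ i, f i ∈ S)
    (hbad : ∀ i j, r i j → ¬ f j ≤ f i) : HasBadSeq S a := by
  rw [← type_toType a, type_le_iff'] at ha
  obtain ⟨g⟩ := ha
  exact ⟨f ∘ g, fun i => hf _, fun i j hij => hbad _ _ (g.map_rel_iff.2 hij)⟩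

theorem HasBadSeq.mono {S T : Set P} {a b : Ordinal.{u}} (h : HasBadSeq S b) (hST : S ⊆ T)
    (hab : a ≤ b) : HasBadSeq T a := by
  obtain ⟨f, hf, hbad⟩ := h
  exact .of_isWellOrder (by rwa [type_toType]) f (fun i => hST (hf i)) hbad

theorem HasBadSeq.add {S A B : Set P} {a b : Ordinal.{u}} (hA : HasBadSeq A a)
    (hB : HasBadSeq B b) (hAS : A ⊆ S) (hBS : B ⊆ S) (hAB : ∀ x ∈ A, ∀ y ∈ B, ¬ y ≤ x) :
    HasBadSeq S (a + b) := by
  obtain ⟨f, hf, hf'⟩ := hA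
  obtain ⟨g, hg, hg'⟩ := hB
  refine .of_isWellOrder (r := Sum.Lex (· < · : a.ToType → a.ToType → Prop)
    (· < · : b.ToType → b.ToType → Prop)) ?_ (Sum.elim f g) ?_ ?_
  · rw [type_sum_lex, type_toType, type_toType]
  · rintro (i | i)
    exacts [hAS (hf i), hBS (hg i)]
  · rintro _ _ (h | h | ⟨i, j⟩)
    exacts [hf' _ _ h, hg' _ _ h, hAB _ (hf _) _ (hg _)]

variable [WellQuasiOrderedLE P]

/-- In a set `S` of stature `a`, with `a` a limit closed under natural sums, there is a chain
along which the statures of the sets `notAbove S x` grow rapidly and are cofinal in `a`. -/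
theorem exists_cofinal_chain {S : Set P} {a : Ordinal.{u}} (hS : stature S = a)
    (hlim : ∀ c < a, c + 1 < a) (hadd : ∀ c < a, ∀ d < a, natAdd c d < a) :
    ∃ C ⊆ S, (∀ c ∈ C, ∀ d ∈ C, c ≠ d → c < d ∨ d < c) ∧
      (∀ c ∈ C, ∀ d ∈ C, c < d → stature (notAbove S c) < stature (notAbove S d) ∧
        natAdd (stature (notAbove S c)) (stature (notAbove S c)) ≤ stature (notAbove S d)) ∧
      ∀ b < a, ∃ c ∈ C, b ≤ stature (notAbove S c) := by
  set g : P → Ordinal.{u} := fun x => stature (notAbove S x) with hg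
  have hga : ∀ x ∈ S, g x < a := fun x hx => hS ▸ stature_notAbove_lt hx
  obtain ⟨D, ⟨hDS, hD⟩, hmin⟩ := (isWellFounded_isNotAbove (P := P)).wf.has_min
    {D | D ⊆ S ∧ ∀ b < a, ∃ x ∈ D, b ≤ g x}
    ⟨S, subset_rfl, fun b hb => lt_stature_iff.1 (hS ▸ hb)⟩
  -- By minimality of D, the elements of D not above x are no longer cofinal, so every element of D
  -- with large enough g lies above x.
  have hdir : ∀ x : D, ∃ b < a, ∀ y ∈ D, b ≤ g y → x.1 ≤ y := by
    intro x
    have h := fun h => hmin (notAbove D x.1) h ⟨x.1, x.2, rfl⟩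
    by_contra! hcon
    refine h ⟨(notAbove_subset D x.1).trans hDS, fun b hb => ?_⟩
    obtain ⟨y, hy, hby, hxy⟩ := hcon b hb
    exact ⟨y, ⟨hy, hxy⟩, hby⟩
  choose γ hγa hγ using hdir
  let bnd : D → Ordinal.{u} := fun x => max (γ x) (max (g x + 1) (natAdd (g x) (g x)))
  have hbnd : ∀ x, bnd x < a := fun x => by
    have hx := hga x.1 (hDS x.2)
    exact max_lt (hγa x) (max_lt (hlim _ hx) (hadd _ hx _ hx))
  let R : D → D → Prop := fun c d => c.1 < d.1 ∧ bnd c ≤ g d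
  let C : Set D := maxChain R
  have hC : IsMaxChain R C := maxChain_spec
  have hcof : ∀ b < a, ∃ c ∈ C, b ≤ g c.1 := by
    by_contra! hcon
    obtain ⟨b, hb, hcb⟩ := hcon
    -- If g is bounded on C, so are the requirements `bnd`: a non-last element is controlled by a
    -- later one, and a last element adds one more bound. An x in D beyond b' would then extend the
    -- maximal chain.
    have hb' : ∃ b' < a, ∀ c ∈ C, bnd c ≤ b' ∧ g c.1 < b' := by
      by_cases hlast : ∃ c ∈ C, ∀ d ∈ C, ¬ R c d
      · obtain ⟨c, hc, hlast⟩ := hlast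
        refine ⟨max b (bnd c), max_lt hb (hbnd c), fun d hd =>
          ⟨?_, (hcb d hd).trans_le (le_max_left _ _)⟩⟩
        rcases eq_or_ne d c with rfl | hne
        · exact le_max_right _ _
        · have hdc := (hC.1 hd hc hne).resolve_right (hlast d hd)
          exact (hdc.2.trans (hcb c hc).le).trans (le_max_left _ _)
      · push Not at hlast
        refine ⟨b, hb, fun c hc => ⟨?_, hcb c hc⟩⟩
        obtain ⟨d, hd, hcd⟩ := hlast c hc
        exact hcd.2.trans (hcb d hd).le
    obtain ⟨b', hb'a, hb'⟩ := hb'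
    obtain ⟨x, hx, hbx⟩ := hD b' hb'a
    have hR : ∀ c ∈ C, R c ⟨x, hx⟩ := by
      intro c hc
      have hle : c.1 ≤ x := hγ c x hx ((le_max_left _ _).trans ((hb' c hc).1.trans hbx))
      refine ⟨lt_of_le_of_ne hle ?_, (hb' c hc).1.trans hbx⟩
      intro h
      exact ((hb' c hc).2.trans_le hbx).ne (congrArg g h)
    have hins := hC.2 (hC.1.insert fun c hc _ => Or.inr (hR c hc)) (Set.subset_insert ⟨x, hx⟩ C)
    have hxC : (⟨x, hx⟩ : D) ∈ C := hins ▸ Set.mem_insert _ _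
    exact ((hb' _ hxC).2.trans_le hbx).false
  have hlt : ∀ c ∈ C, ∀ d ∈ C, c.1 < d.1 → bnd c ≤ g d := by
    intro c hc d hd hcd
    rcases hC.1 hc hd (by rintro rfl; exact hcd.false) with h | h
    · exact h.2
    · exact (hcd.trans h.1).false.elim
  refine ⟨Subtype.val '' C, ?_, ?_, ?_, ?_⟩
  · rintro _ ⟨c, -, rfl⟩
    exact hDS c.2
  · rintro _ ⟨c, hc, rfl⟩ _ ⟨d, hd, rfl⟩ hne
    exact (hC.1 hc hd (fun h => hne (congrArg _ h))).imp And.left And.left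
  · rintro _ ⟨c, hc, rfl⟩ _ ⟨d, hd, rfl⟩ hcd
    have h := max_le_iff.1 ((le_max_right _ _).trans (hlt c hc d hd hcd))
    exact ⟨lt_of_lt_of_le (lt_add_one _) h.1, h.2⟩
  · intro b hb
    obtain ⟨c, hc, hbc⟩ := hcof b hb
    exact ⟨c.1, ⟨c, hc, rfl⟩, hbc⟩

/-- Cut the part of S above the chain into blocks, the block of c lying above c but above no later
chain element. The growth condition makes this block have stature at least g c, so it carries a bad
sequence of that length. Concatenating along the chain stays bad, and the lengths are cofinal in a.
-/
theorem hasBadSeq_of_principal {S : Set P} {a : Ordinal.{u}} (hS : stature S = a)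
    (hlim : ∀ c < a, c + 1 < a) (hadd : ∀ c < a, ∀ d < a, natAdd c d < a)
    (ih : ∀ T : Set P, stature T < a → HasBadSeq T (stature T)) : HasBadSeq S a := by
  obtain ⟨C, hCS, htot, hgrow, hcof⟩ := exists_cofinal_chain hS hlim hadd
  set g : P → Ordinal.{u} := fun x => stature (notAbove S x) with hg
  have hga : ∀ x ∈ S, g x < a := fun x hx => hS ▸ stature_notAbove_lt hx
  let L : P → Set P := fun c => {z ∈ S | c ≤ z ∧ ∀ d ∈ C, c < d → ¬ d ≤ z}
  have hL : ∀ c : C, HasBadSeq (L c) (g c) := by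
    rintro ⟨c, hc⟩
    have hne : {d ∈ C | c < d}.Nonempty := by
      obtain ⟨d, hd, hcd⟩ := hcof _ (hlim _ (hga c (hCS hc)))
      have hcd' : g c < g d := lt_of_lt_of_le (lt_add_one _) hcd
      refine ⟨d, hd, (htot c hc d hd ?_).resolve_right fun h => ?_⟩
      · rintro rfl
        exact hcd'.false
      · exact ((hgrow d hd c hc h).1.trans hcd').false
    obtain ⟨d, ⟨hd, hcd⟩, hmin⟩ := (wellFounded_lt (α := P)).has_min _ hne
    have hdmin : ∀ d' ∈ C, c < d' → d ≤ d' := by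
      intro d' hd' hcd'
      by_contra hle
      exact hmin d' ⟨hd', hcd'⟩
        ((htot d hd d' hd' (by rintro rfl; exact hle le_rfl)).resolve_left fun h => hle h.le)
    have hLd : stature (L c) ≤ g d :=
      stature_mono fun z hz => ⟨hz.1, hz.2.2 d hd hcd⟩
    refine (ih (L c) (hLd.trans_lt (hga d (hCS hd)))).mono subset_rfl ?_
    by_contra! hlt
    -- With d the successor of c in the chain, a block of stature below g c would make g d smaller
    -- than the natural sum of g c with itself.
    have hsub : notAbove S d ⊆ notAbove S c ∪ L c := by
      intro z hz
      by_cases hcz : c ≤ z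
      · exact Or.inr ⟨hz.1, hcz, fun d' hd' hcd' h => hz.2 ((hdmin d' hd' hcd').trans h)⟩
      · exact Or.inl ⟨hz.1, hcz⟩
    exact ((hgrow c hc d hd hcd).2.trans ((stature_mono hsub).trans (stature_union_le _ _))).not_gt
      (natAdd_lt_natAdd_right _ hlt)
  choose F hF hbad using hL
  have hinj : ∀ c d : C, g c = g d → c = d := by
    intro c d h
    by_contra hne
    rcases htot c c.2 d d.2 (fun h => hne (Subtype.ext h)) with h' | h'
    · exact (hgrow _ c.2 _ d.2 h').1.ne h
    · exact (hgrow _ d.2 _ c.2 h').1.ne' h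
  let A := Σ c : C, (g c).ToType
  let pos : A ↪ Ordinal.{u} ×ₗ Ordinal.{u} :=
    { toFun := fun p => toLex (g p.1, (p.2.toOrd : Ordinal.{u}))
      inj' := by
        rintro ⟨c, i⟩ ⟨d, j⟩ h
        have h' := toLex.injective h
        simp only [Prod.mk.injEq] at h'
        obtain rfl := hinj c d h'.1
        have hij : i = j := ToType.mk.symm.injective (Subtype.ext h'.2)
        rw [hij] }
  let r : A → A → Prop := fun p q => pos p < pos q
  have hr : IsWellOrder A r := (RelEmbedding.preimage pos (· < ·)).isWellOrder
  have hlex : ∀ p q : A, r p q ↔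
      g p.1 < g q.1 ∨ g p.1 = g q.1 ∧ (p.2.toOrd : Ordinal.{u}) < q.2.toOrd :=
    fun p q => Prod.Lex.toLex_lt_toLex
  refine .of_isWellOrder (r := r) ?_ (fun p => F p.1 p.2) (fun p => (hF p.1 p.2).1) ?_
  · refine le_of_forall_lt fun b hb => ?_
    obtain ⟨c, hc, hbc⟩ := hcof _ (hlim b hb)
    refine lt_of_lt_of_le (lt_add_one b) (hbc.trans ?_)
    change g c ≤ _
    rw [← type_toType (g c), type_le_iff']
    refine ⟨⟨⟨fun i => ⟨⟨c, hc⟩, i⟩, fun i j h => eq_of_heq (Sigma.mk.inj h).2⟩, ?_⟩⟩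
    intro i j
    change r ⟨⟨c, hc⟩, i⟩ ⟨⟨c, hc⟩, j⟩ ↔ i < j
    rw [hlex]
    simp
  · rintro ⟨c, i⟩ ⟨d, j⟩ hpq
    rcases (hlex _ _).1 hpq with h | ⟨h, h'⟩
    · have hcd : c.1 < d.1 := by
        refine (htot c c.2 d d.2 ?_).resolve_right fun h' => ?_
        · intro h'
          exact h.ne (congrArg g h')
        · exact (h.trans (hgrow d d.2 c c.2 h').1).false
      exact fun hle => (hF c i).2.2 d d.2 hcd ((hF d j).2.1.trans hle)
    · obtain rfl := hinj c d h
      exact hbad c i j (by simpa using h')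

/-- Induction on the stature: splitting off the last power of ω, or the whole remainder,
concatenates two shorter sequences. Only stature ω^e itself is indecomposable; it is one element for
e = 0, and otherwise the cofinal chain applies. -/
theorem hasBadSeq_stature (S : Set P) : HasBadSeq S (stature S) := by
  obtain ⟨a, ha⟩ : ∃ a, stature S = a := ⟨_, rfl⟩
  induction a using WellFoundedLT.induction generalizing S with
  | ind a ih =>
  have ih' : ∀ T : Set P, stature T < a → HasBadSeq T (stature T) := fun T hT => ih _ hT T rfl
  rcases eq_or_ne a 0 with rfl | ha0
  · rw [ha]
    exact ⟨fun i => isEmptyElim i, fun i => isEmptyElim i, fun i => isEmptyElim i⟩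
  have split : ∀ {e b r : Ordinal.{u}}, r ≤ ω ^ e → a = ω ^ e * b + r → ω ^ e * b < a → r < a →
      HasBadSeq S (stature S) := by
    intro e b r hr hab hb hra
    obtain ⟨A, hAS, hA, hAb, hr⟩ := exists_split hr (ha.trans hab)
    have h₁ := ih' A (hAb ▸ hb)
    have h₂ := ih' (S \ A) (hr ▸ hra)
    rw [ha, hab, ← hAb, ← hr]
    exact h₁.add h₂ hAS Set.sdiff_subset fun x hx y hy hyx => hy.2 (hA x hx y hy.1 hyx)
  set e := log ω a
  have hpos : 0 < ω ^ e := opow_pos e omega0_pos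
  obtain ⟨n, hn⟩ := lt_omega0.1 (div_opow_log_lt a one_lt_omega0)
  have hn0 : n ≠ 0 := by
    rintro rfl
    exact (div_opow_log_pos ω ha0).ne' (by simpa using hn)
  have hdm := div_add_mod a (ω ^ e)
  rw [hn] at hdm
  have hmod : a % ω ^ e < ω ^ e := mod_lt a hpos.ne'
  have hle : ω ^ e ≤ a := opow_log_le_self ω ha0
  rcases eq_or_ne (a % ω ^ e) 0 with h0 | h0
  · rw [h0, add_zero] at hdm
    obtain ⟨m, rfl⟩ := Nat.exists_eq_succ_of_ne_zero hn0
    rw [Nat.succ_eq_add_one, Nat.cast_add_one, mul_add_one] at hdm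
    rcases eq_or_ne m 0 with rfl | hm
    · have hae : a = ω ^ e := by simpa using hdm.symm
      rcases eq_or_ne e 0 with he | he
      · rw [he, opow_zero] at hae
        obtain ⟨x, hx, -⟩ := lt_stature_iff.1 (ha ▸ pos_iff_ne_zero.2 ha0)
        rw [ha, hae]
        exact ⟨fun _ => x, fun _ => hx, fun i j h => (h.ne (Subsingleton.elim i j)).elim⟩
      · have hl : IsSuccLimit (ω ^ e) := isSuccLimit_opow_left isSuccLimit_omega0 he
        rw [ha]
        refine hasBadSeq_of_principal ha ?_ ?_ ih'
        · rw [hae]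
          exact fun c hc => hl.add_one_lt hc
        · rw [hae]
          exact natAdd_lt_omega0_opow e
    · have hm' : ω ^ e ≤ ω ^ e * m :=
        Ordinal.le_mul_left _ (by exact_mod_cast Nat.pos_of_ne_zero hm)
      refine split le_rfl hdm.symm ?_ ?_
      · rw [← hdm]
        simpa using hpos
      · rw [← hdm]
        exact lt_of_lt_of_le (by simpa using hpos) (add_le_add_left hm' _)
  · refine split hmod.le hdm.symm ?_ (hmod.trans_le hle)
    conv_rhs => rw [← hdm]
    simpa [pos_iff_ne_zero] using h0

theorem isWellOrder_of_isLinearisation {r : P → P → Prop} (hr : IsLinearisation P r) :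
    IsWellOrder P r := by
  have := hr.isStrictTotalOrder
  have hwf : WellFounded r := by
    refine wellFounded_iff_isEmpty_descending_chain.2 ⟨fun ⟨f, hf⟩ => ?_⟩
    have hanti : ∀ m n, m < n → r (f n) (f m) := fun m n hmn => by
      induction n, hmn using Nat.le_induction with
      | base => exact hf m
      | succ n _ ih => exact _root_.trans (hf n) ih
    obtain ⟨m, n, hmn, hle⟩ := wellQuasiOrdered_le f
    rcases hle.eq_or_lt with h | h
    · exact irrefl (r := r) (f m) (by simpa [h] using hanti m n hmn)
    · exact irrefl (r := r) _ (_root_.trans (hanti m n hmn) (hr.extends_lt _ _ h))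
  exact { wf := hwf }

/-- Badness says that the order never contradicts the indices, so adding the order of the indices to
that of P keeps antisymmetry; any linear extension then contains the sequence in increasing order.
-/
theorem exists_isLinearisation_of_hasBadSeq {a : Ordinal.{u}}
    (h : HasBadSeq (Set.univ : Set P) a) :
    ∃ r : P → P → Prop, IsLinearisation P r ∧ ∃ _ : IsWellOrder P r, a ≤ type r := by
  obtain ⟨f, -, hbad⟩ := h
  have hrefl : ∀ i j, f i ≤ f j → i ≤ j := fun i j hij => not_lt.1 fun h => hbad j i h hij
  let s : P → P → Prop := fun x y => x ≤ y ∨ ∃ i j, i ≤ j ∧ x ≤ f i ∧ f j ≤ y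
  have hs : IsPartialOrder P s :=
    { refl := fun x => Or.inl le_rfl
      trans := by
        rintro x y z (hxy | ⟨i, j, hij, hx, hy⟩) (hyz | ⟨i', j', hij', hy', hz⟩)
        · exact Or.inl (hxy.trans hyz)
        · exact Or.inr ⟨i', j', hij', hxy.trans hy', hz⟩
        · exact Or.inr ⟨i, j, hij, hx, hy.trans hyz⟩
        · exact Or.inr ⟨i, j', hij.trans ((hrefl _ _ (hy.trans hy')).trans hij'), hx, hz⟩
      antisymm := by
        rintro x y (hxy | ⟨i, j, hij, hx, hy⟩) (hyx | ⟨i', j', hij', hy', hx'⟩)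
        · exact hxy.antisymm hyx
        · obtain rfl := hij'.antisymm (hrefl _ _ (hx'.trans (hxy.trans hy')))
          exact hxy.antisymm (hy'.trans hx')
        · obtain rfl := hij.antisymm (hrefl _ _ (hy.trans (hyx.trans hx)))
          exact (hx.trans hy).antisymm hyx
        · have h₁ := hrefl _ _ (hy.trans hy')
          have h₂ := hrefl _ _ (hx'.trans hx)
          obtain rfl := hij.antisymm (h₁.trans (hij'.trans h₂))
          obtain rfl := hij'.antisymm (h₂.trans h₁)
          exact (hx.trans hy).antisymm (hy'.trans hx') }
  obtain ⟨t, ht, hst⟩ := extend_partialOrder s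
  let r : P → P → Prop := fun x y => t x y ∧ x ≠ y
  have hr : IsLinearisation P r :=
    { isStrictTotalOrder :=
        { irrefl := fun x h => h.2 rfl
          trans := by
            rintro x y z ⟨hxy, hne⟩ ⟨hyz, -⟩
            refine ⟨_root_.trans hxy hyz, ?_⟩
            rintro rfl
            exact hne (antisymm hxy hyz)
          trichotomous := by
            intro x y h₁ h₂
            by_contra hne
            rcases total_of t x y with h | h
            exacts [h₁ ⟨h, hne⟩, h₂ ⟨h, Ne.symm hne⟩] }
      extends_lt := fun x y hxy => ⟨hst _ _ (Or.inl hxy.le), hxy.ne⟩ }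
  have hwo := isWellOrder_of_isLinearisation hr
  refine ⟨r, hr, hwo, ?_⟩
  rw [← type_toType a, type_le_iff']
  refine ⟨RelEmbedding.ofMonotone f fun i j hij => ⟨?_, fun h => ?_⟩⟩
  · exact hst _ _ (Or.inr ⟨i, j, hij.le, le_rfl, le_rfl⟩)
  · exact hbad i j hij h.ge

/-- Elements preceding x in the linearisation are never above x, so the initial segment at x
survives the removal at x, and positions are bounded inductively by statures of initial segments. -/
theorem type_le_stature_of_isLinearisation {r : P → P → Prop} (hr : IsLinearisation P r)
    [IsWellOrder P r] : type r ≤ stature (Set.univ : Set P) := by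
  have hsub : ∀ (S : Set P) (x : P), {y | r y x} ⊆ S → {y | r y x} ⊆ notAbove S x := by
    intro S x hS y hy
    refine ⟨hS hy, fun hle => ?_⟩
    rcases hle.eq_or_lt with rfl | h
    · exact irrefl (r := r) _ hy
    · exact irrefl (r := r) _ (_root_.trans hy (hr.extends_lt _ _ h))
  have key : ∀ x, typein r x ≤ stature {y | r y x} := by
    intro x
    induction x using (IsWellFounded.wf (r := r)).induction with
    | h x ih =>
    by_contra! hlt
    obtain ⟨y, hy⟩ := typein_surj r (hlt.trans (typein_lt_type r x))
    have hyx : r y x := (typein_lt_typein r).1 (hy ▸ hlt)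
    have h := (ih y hyx).trans (stature_mono (hsub {z | r z x} y fun z hz => _root_.trans hz hyx))
    exact (h.trans_lt (stature_notAbove_lt hyx)).ne hy
  by_contra! hlt
  obtain ⟨y, hy⟩ := typein_surj r hlt
  have h := (key y).trans (stature_mono (hsub Set.univ y (Set.subset_univ _)))
  exact (h.trans_lt (stature_notAbove_lt (Set.mem_univ y))).ne hy

variable (P)

theorem isGreatest_stature_univ : IsGreatest (linearisationTypes P) (stature (Set.univ : Set P)) := by
  constructor
  · obtain ⟨r, hr, hwo, hle⟩ := exists_isLinearisation_of_hasBadSeq (P := P)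
      (hasBadSeq_stature Set.univ)
    exact ⟨r, hr, hwo, (type_le_stature_of_isLinearisation hr).antisymm hle⟩
  · rintro _ ⟨r, hr, hwo, rfl⟩
    exact type_le_stature_of_isLinearisation hr

theorem maximalOrderType_eq_stature : maximalOrderType P = stature (Set.univ : Set P) :=
  (isGreatest_stature_univ P).csSup_eq

end Linearisation

/-! ### Stature of lexicographic products -/

section LexProduct

variable {P Q : Type u}

/-- The pairs with `Q`-component in `D` and `P`-component in `A`. -/
def lexProd (D : Set Q) (A : Set P) : Set (LexProduct P Q) :=
  {x | (ofLex x).1 ∈ D ∧ (ofLex x).2 ∈ A}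

theorem lexProd_mono {D D' : Set Q} {A A' : Set P} (hD : D ⊆ D') (hA : A ⊆ A') :
    lexProd D A ⊆ lexProd D' A' :=
  fun _ hx => ⟨hD hx.1, hA hx.2⟩

variable [PartialOrder P] [PartialOrder Q]

theorem lexProduct_le_iff {x y : LexProduct P Q} :
    x ≤ y ↔ (ofLex x).1 < (ofLex y).1 ∨ (ofLex x).1 = (ofLex y).1 ∧ (ofLex x).2 ≤ (ofLex y).2 :=
  Prod.Lex.le_iff

/-- The maximal elements of a set. -/
def maximals (D : Set Q) : Set Q := {q ∈ D | ∀ q' ∈ D, ¬ q < q'}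

theorem isAntichain_maximals (D : Set Q) : IsAntichain (· ≤ ·) (maximals D) :=
  fun _ hx _ hy hne hle => hx.2 _ hy.1 (lt_of_le_of_ne hle hne)

theorem maximals_univ : maximals (Set.univ : Set Q) = {q | IsMax q} := by
  ext q
  simp [maximals, isMax_iff_forall_not_lt]

variable [WellQuasiOrderedLE P] [WellQuasiOrderedLE Q]

instance : WellQuasiOrderedLE (LexProduct P Q) := wellQuasiOrderedLE_lexProduct P Q

theorem stature_lexProd_singleton (q : Q) (A : Set P) :
    stature (lexProd {q} A) = stature A := by
  apply le_antisymm
  · refine stature_le_of_map (fun x : LexProduct P Q => (ofLex x).2) (fun x hx => hx.2) ?_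
    rintro x ⟨hx, -⟩ y ⟨hy, -⟩ hle
    exact lexProduct_le_iff.2 (Or.inr ⟨Eq.trans hx hy.symm, hle⟩)
  · refine stature_le_of_map (fun p => (toLex (q, p) : LexProduct P Q)) (fun p hp => ⟨rfl, hp⟩) ?_
    intro x _ y _ hle
    simpa [lexProduct_le_iff] using hle

/-- For q in D, the fibre over q can be placed after the product over the elements not above q, so
each step in D gains a full summand o(A). -/
theorem mul_stature_le_stature_lexProd (D : Set Q) (A : Set P) :
    stature A * stature D ≤ stature (lexProd D A) := by
  induction D using notAbove_induction with
  | ih D ih =>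
  rcases eq_or_ne (stature A) 0 with h0 | h0
  · simp [h0]
  by_contra! hlt
  rw [Ordinal.lt_mul_iff_div_lt h0] at hlt
  obtain ⟨q, hq, hle⟩ := lt_stature_iff.1 hlt
  have hsum := stature_add_le (A := lexProd (notAbove D q) A) (B := lexProd {q} A)
    (S := lexProd D A) (lexProd_mono (notAbove_subset D q) subset_rfl)
    (lexProd_mono (Set.singleton_subset_iff.2 hq) subset_rfl) (by
      rintro a ⟨⟨-, ha⟩, -⟩ b ⟨hb, -⟩ hba
      obtain rfl : (ofLex b).1 = q := hb
      rcases lexProduct_le_iff.1 hba with h | h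
      exacts [ha h.le, ha h.1.le])
  rw [stature_lexProd_singleton] at hsum
  refine (Ordinal.lt_mul_succ_div (stature (lexProd D A)) h0).not_ge (le_trans ?_ hsum)
  rw [mul_succ]
  exact add_le_add_left ((mul_le_mul_right hle _).trans (ih q hq)) _

theorem stature_eq_ncard {M : Set Q} (hM : IsAntichain (· ≤ ·) M) :
    stature M = (M.ncard : Ordinal.{u}) := by
  induction M using notAbove_induction with
  | ih M ih =>
  have hfin : M.Finite := WellQuasiOrderedLE.finite_of_isAntichain hM
  have hrem : ∀ x ∈ M, stature (notAbove M x) + 1 = (M.ncard : Ordinal.{u}) := by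
    intro x hx
    have hxM : notAbove M x = M \ {x} := by
      ext y
      refine ⟨fun hy => ⟨hy.1, fun h => hy.2 h.ge⟩, fun hy => ⟨hy.1, fun h => hy.2 ?_⟩⟩
      exact (hM.eq hx hy.1 h).symm
    rw [ih x hx (hM.subset (notAbove_subset M x)), hxM,
      ← Set.ncard_sdiff_singleton_add_one hx hfin]
    norm_cast
  apply le_antisymm
  · refine stature_le_iff.2 fun x hx => ?_
    rw [← hrem x hx]
    exact lt_add_one _
  · rcases M.eq_empty_or_nonempty with rfl | ⟨x, hx⟩
    · simp
    · rw [← hrem x hx]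
      exact succ_le_of_lt (stature_notAbove_lt hx)

theorem stature_lexProd_le_hessenbergMul {M : Set Q} (hM : M.Finite) (B : Set P) :
    stature (lexProd M B) ≤ hessenbergMul (stature B) (M.ncard : Ordinal.{u}) := by
  induction M, hM using Set.Finite.induction_on with
  | empty =>
    rw [(stature_eq_zero_iff (S := lexProd (∅ : Set Q) B)).2]
    · exact zero_le
    · ext x
      simp [lexProd]
  | @insert q M hq hM ih =>
    rw [Set.ncard_insert_of_notMem hq hM]
    refine le_trans ?_ (natAdd_hessenbergMul_le _ _)
    have hsub : lexProd (insert q M) B ⊆ lexProd M B ∪ lexProd {q} B := by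
      rintro x ⟨hx | hx, hxB⟩
      exacts [Or.inr ⟨hx, hxB⟩, Or.inl ⟨hx, hxB⟩]
    refine (stature_mono hsub).trans ((stature_union_le _ _).trans ?_)
    exact natAdd_le_natAdd ih (stature_lexProd_singleton q B).le

/-- The copies of B are incomparable, so the leading parts of all of them may precede all the
remainders; repeating this along the Cantor normal form gives the polynomial product. -/
theorem hessenbergMul_le_stature_lexProd {M : Set Q} (hM : IsAntichain (· ≤ ·) M) (B : Set P) :
    hessenbergMul (stature B) (M.ncard : Ordinal.{u}) ≤ stature (lexProd M B) := by
  obtain ⟨c, hc⟩ : ∃ c, stature B = c := ⟨_, rfl⟩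
  rw [hc]
  induction c using cnf_induction generalizing B with
  | zero => simp [hessenbergMul_zero_left]
  | step e n r hn hr ih =>
    obtain ⟨A, hAB, hA, hAn, hAr⟩ := exists_split hr.le hc
    rw [hessenbergMul_opow_mul_add _ hn hr]
    refine le_trans (add_le_add ?_ (ih _ hAr)) (stature_add_le (A := lexProd M A)
      (lexProd_mono subset_rfl hAB) (lexProd_mono subset_rfl Set.sdiff_subset) ?_)
    · rw [← mul_assoc, ← hAn, ← stature_eq_ncard hM]
      exact mul_stature_le_stature_lexProd M A
    · rintro a ⟨haM, haA⟩ b ⟨hbM, hbB, hbA⟩ hba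
      rcases lexProduct_le_iff.1 hba with h | h
      · exact hM hbM haM h.ne h.le
      · exact hbA (hA _ haA _ hbB h.2)

theorem exists_eq_mul_add_of_lt_mul {w s : Ordinal.{u}} {n : ℕ} (hw : w ≠ 0) (hs : s < w * n) :
    ∃ (m : ℕ) (r : Ordinal.{u}), m + 1 ≤ n ∧ r < w ∧ s = w * m + r := by
  rw [Ordinal.lt_mul_iff_div_lt hw] at hs
  obtain ⟨m, hm⟩ := lt_omega0.1 (hs.trans (natCast_lt_omega0 n))
  rw [hm] at hs
  exact ⟨m, s % w, by exact_mod_cast hs, mod_lt s hw, by rw [← hm, div_add_mod]⟩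

/-- If `P` has maximal order type `ω ^ e * n + r`, then the maximal order type of the lexicographic
product of `P` along `D` is at most `ω ^ e * n * o(D)` plus one copy of `r` for each maximal element
of `D`. -/
theorem stature_lexProd_univ_le {e r : Ordinal.{u}} {n : ℕ} (hn : n ≠ 0) (hr : r < ω ^ e)
    (hP : stature (Set.univ : Set P) = ω ^ e * n + r) (D : Set Q) :
    stature (lexProd D (Set.univ : Set P)) ≤
      ω ^ e * (n * stature D) + hessenbergMul r ((maximals D).ncard : Ordinal.{u}) := by
  have hw : ω ^ e ≠ 0 := (opow_pos e omega0_pos).ne'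
  obtain ⟨A, -, -, hA, hAr⟩ := exists_split hr.le hP
  obtain ⟨p₀, hp₀⟩ : A.Nonempty := by
    rw [Set.nonempty_iff_ne_empty, Ne, ← stature_eq_zero_iff, hA]
    simp [hw, hn]
  -- Removal at a point of A costs a whole unit of ω^e, which absorbs the remainder r.
  have hAlt : ∀ p ∈ A, stature (notAbove Set.univ p) < ω ^ e * n := by
    intro p hp
    obtain ⟨m, s, hm, hs, hps⟩ := exists_eq_mul_add_of_lt_mul hw (hA ▸ stature_notAbove_lt hp)
    have hsub : notAbove Set.univ p ⊆ notAbove A p ∪ (Set.univ \ A) := by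
      intro y hy
      by_cases hyA : y ∈ A
      exacts [Or.inl ⟨hyA, hy.2⟩, Or.inr ⟨trivial, hyA⟩]
    refine ((stature_mono hsub).trans (stature_union_le _ _)).trans_lt ?_
    have h := natAdd_mul_add_lt e (b := m) 0 hs hr
    simp only [Nat.cast_zero, mul_zero, zero_add, add_zero] at h
    rw [hps, hAr]
    refine h.trans_le (mul_le_mul_right ?_ _)
    exact_mod_cast hm
  induction D using notAbove_induction with
  | ih D ih =>
  have hfin : (maximals D).Finite :=
    WellQuasiOrderedLE.finite_of_isAntichain (isAntichain_maximals D)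
  -- T omits exactly the remainders over maximal elements of D. The claim is that those over
  -- non-maximal elements do not raise its stature above ω^e·n·o(D).
  let T : Set (LexProduct P Q) := {x | (ofLex x).1 ∈ D ∧ ((ofLex x).2 ∈ A ∨
    (ofLex x).1 ∉ maximals D)}
  have hTA : ∀ q ∈ D, ∀ p ∈ A,
      stature (notAbove T (toLex (q, p))) < ω ^ e * (n * stature D) := by
    intro q hq p hp
    have hsub : notAbove T (toLex (q, p)) ⊆
        lexProd (notAbove D q) Set.univ ∪ lexProd {q} (notAbove Set.univ p) := by
      rintro x ⟨⟨hxD, -⟩, hx⟩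
      by_cases hqx : q ≤ (ofLex x).1
      · rcases hqx.eq_or_lt with h | h
        · exact Or.inr ⟨h.symm, trivial, fun hle => hx (lexProduct_le_iff.2 (Or.inr ⟨h, hle⟩))⟩
        · exact (hx (lexProduct_le_iff.2 (Or.inl h))).elim
      · exact Or.inl ⟨⟨hxD, hqx⟩, trivial⟩
    obtain ⟨m, s, hm, hs, hps⟩ := exists_eq_mul_add_of_lt_mul hw (hAlt p hp)
    refine ((stature_mono hsub).trans (stature_union_le _ _)).trans_lt ?_
    rw [stature_lexProd_singleton, hps]
    refine (natAdd_le_natAdd (ih q hq) le_rfl).trans_lt ?_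
    refine (natAdd_mul_add_lt e m (hessenbergMul_natCast_lt _ hr) hs).trans_le ?_
    refine mul_le_mul_right ?_ _
    calc (n : Ordinal.{u}) * stature (notAbove D q) + m + 1
        ≤ n * stature (notAbove D q) + n := by
          rw [add_assoc]
          exact add_le_add_right (by exact_mod_cast hm) _
      _ = n * succ (stature (notAbove D q)) := (mul_succ _ _).symm
      _ ≤ n * stature D := mul_le_mul_right (succ_le_of_lt (stature_notAbove_lt hq)) _
  have hT : stature T ≤ ω ^ e * (n * stature D) := by
    refine stature_le_iff.2 ?_
    rintro x ⟨hxD, hx⟩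
    by_cases hxA : (ofLex x).2 ∈ A
    · exact hTA _ hxD _ hxA
    have hmax := hx.resolve_left hxA
    obtain ⟨q, hq, hxq⟩ : ∃ q ∈ D, (ofLex x).1 < q := by
      by_contra! h
      exact hmax ⟨hxD, h⟩
    -- A remainder point over a non-maximal element lies below a leading point over q, so removal at
    -- x leaves even less.
    have hle : x ≤ toLex (q, p₀) := lexProduct_le_iff.2 (Or.inl hxq)
    have hsub : notAbove T x ⊆ notAbove T (toLex (q, p₀)) :=
      fun y hy => ⟨hy.1, fun h => hy.2 (hle.trans h)⟩
    exact (stature_mono hsub).trans_lt (hTA q hq p₀ hp₀)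
  have hsub : lexProd D Set.univ ⊆ T ∪ lexProd (maximals D) (Set.univ \ A) := by
    rintro x ⟨hxD, -⟩
    by_cases h : (ofLex x).2 ∈ A ∨ (ofLex x).1 ∉ maximals D
    · exact Or.inl ⟨hxD, h⟩
    · push Not at h
      exact Or.inr ⟨h.2, trivial, h.1⟩
  refine (stature_mono hsub).trans ((stature_union_le _ _).trans ?_)
  have hB := stature_lexProd_le_hessenbergMul hfin (Set.univ \ A)
  rw [hAr] at hB
  exact (natAdd_le_natAdd hT hB).trans (natAdd_mul_le_add e (hessenbergMul_natCast_lt _ hr))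

variable (Q)

/-- No maximal element lies below a non-maximal one, which gives one inequality; the other holds
because adding a natural number naturally gives at most the ordinary sum. -/
theorem stature_not_isMax_add :
    stature {q : Q | ¬ IsMax q} + ({q : Q | IsMax q}.ncard : Ordinal.{u}) =
      stature (Set.univ : Set Q) := by
  rw [← maximals_univ, ← stature_eq_ncard (isAntichain_maximals (Set.univ : Set Q))]
  apply le_antisymm
  · refine stature_add_le (Set.subset_univ _) (Set.subset_univ _) fun a ha b hb hba => ?_
    rw [maximals_univ] at hb
    exact ha (hb.eq_of_le hba ▸ hb)
  · have h := stature_union_le {q : Q | ¬ IsMax q} (maximals Set.univ)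
    have hunion : {q : Q | ¬ IsMax q} ∪ maximals Set.univ = Set.univ := by
      rw [maximals_univ]
      ext q
      simpa using (em (IsMax q)).symm
    rw [hunion] at h
    refine h.trans ?_
    rw [stature_eq_ncard (isAntichain_maximals (Set.univ : Set Q))]
    exact natAdd_natCast_le _ _

variable (P) in
theorem stature_lexProduct :
    stature (Set.univ : Set (LexProduct P Q)) =
      stature (Set.univ : Set P) * stature {q : Q | ¬ IsMax q} +
        hessenbergMul (stature (Set.univ : Set P)) ({q : Q | IsMax q}.ncard : Ordinal.{u}) := by
  have huniv : (Set.univ : Set (LexProduct P Q)) = lexProd Set.univ Set.univ := by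
    ext x
    simp [lexProd]
  rw [huniv]
  apply le_antisymm
  · rcases eq_or_ne (stature (Set.univ : Set P)) 0 with h0 | h0
    · have : lexProd (Set.univ : Set Q) (Set.univ : Set P) = ∅ := by
        rw [stature_eq_zero_iff.1 h0]
        ext x
        simp [lexProd]
      rw [stature_eq_zero_iff.2 this]
      exact zero_le
    obtain ⟨e, n, r, hn, hr, hP⟩ : ∃ (e : Ordinal.{u}) (n : ℕ) (r : Ordinal.{u}), n ≠ 0 ∧
        r < ω ^ e ∧ stature (Set.univ : Set P) = ω ^ e * n + r := by
      revert h0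
      generalize stature (Set.univ : Set P) = a
      induction a using cnf_induction with
      | zero => exact fun h => (h rfl).elim
      | step e n r hn hr _ => exact fun _ => ⟨e, n, r, hn, hr, rfl⟩
    refine (stature_lexProd_univ_le hn hr hP Set.univ).trans ?_
    rw [maximals_univ, ← stature_not_isMax_add, hP, hessenbergMul_opow_mul_add _ hn hr, mul_add,
      mul_add, ← mul_assoc, add_assoc]
    -- The k leading terms and the r ⊗ k already agree on both sides; what remains is ω^e·n ≤ o(P).
    refine add_le_add_left (mul_le_mul_left ?_ _) _
    exact le_self_add
  · refine le_trans (add_le_add (mul_stature_le_stature_lexProd _ _)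
      (hessenbergMul_le_stature_lexProd (maximals_univ (Q := Q) ▸ isAntichain_maximals _) _))
      (stature_add_le (lexProd_mono (Set.subset_univ _) subset_rfl)
        (lexProd_mono (Set.subset_univ _) subset_rfl) ?_)
    rintro a ⟨ha, -⟩ b ⟨hb, -⟩ hba
    have hle : (ofLex b).1 ≤ (ofLex a).1 := by
      rcases lexProduct_le_iff.1 hba with h | h
      exacts [h.le, h.1.le]
    exact ha (IsMax.eq_of_le hb hle ▸ hb)

variable {Q}

/-- If c is reached by removing above x, take y above x: removing first above y and then above x
gains one more step. -/
theorem isSuccPrelimit_stature (h : ∀ q : Q, ¬ IsMax q) :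
    IsSuccPrelimit (stature (Set.univ : Set Q)) := by
  refine isSuccPrelimit_of_succ_lt fun c hc => ?_
  obtain ⟨x, -, hcx⟩ := lt_stature_iff.1 hc
  obtain ⟨y, hxy⟩ := not_isMax_iff.1 (h x)
  have hx : x ∈ notAbove Set.univ y := ⟨trivial, hxy.not_ge⟩
  have hsub : notAbove Set.univ x ⊆ notAbove (notAbove Set.univ y) x :=
    fun z hz => ⟨⟨trivial, fun hyz => hz.2 (hxy.le.trans hyz)⟩, hz.2⟩
  have hlt := (stature_mono hsub).trans_lt (stature_notAbove_lt hx)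
  exact (succ_le_of_lt (hcx.trans_lt hlt)).trans_lt (stature_notAbove_lt trivial)

end LexProduct

/-! ### Limit and finite parts; the theorem -/

theorem exists_isSuccPrelimit_add_natCast (a : Ordinal.{u}) :
    ∃ (d : Ordinal.{u}) (m : ℕ), IsSuccPrelimit d ∧ a = d + m := by
  induction a using Ordinal.limitRecOn with
  | zero => exact ⟨0, 0, isSuccPrelimit_bot, by simp⟩
  | add_one a ih =>
    obtain ⟨d, m, hd, rfl⟩ := ih
    exact ⟨d, m + 1, hd, by rw [Nat.cast_add_one, add_assoc]⟩
  | limit a ha _ => exact ⟨a, 0, ha.isSuccPrelimit, by simp⟩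

theorem not_isSuccPrelimit_add_natCast (a : Ordinal.{u}) {n : ℕ} (hn : n ≠ 0) :
    ¬ IsSuccPrelimit (a + n) := by
  obtain ⟨m, rfl⟩ := Nat.exists_eq_succ_of_ne_zero hn
  rw [Nat.succ_eq_add_one, Nat.cast_add_one, ← add_assoc]
  exact not_isSuccPrelimit_succ (a + m)

theorem mainTheorem1 {P Q : Type u} [PartialOrder P] [PartialOrder Q]
    [WellQuasiOrderedLE P] [WellQuasiOrderedLE Q]
    (k : ℕ) (hk : {q : Q | IsMax q}.ncard = k) :
    -- the three maximal order types are maxima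
    IsGreatest (linearisationTypes P) (maximalOrderType P) ∧
    IsGreatest (linearisationTypes Q) (maximalOrderType Q) ∧
    IsGreatest (linearisationTypes (LexProduct P Q)) (maximalOrderType (LexProduct P Q)) ∧
    -- `o(Q) = δ + m` for some limit ordinal `δ` (possibly `0`) and some natural number `m`
    (∃ (δ : Ordinal.{u}) (m : ℕ), Order.IsSuccPrelimit δ ∧ maximalOrderType Q = δ + m) ∧
    -- for every such decomposition, `m ≥ k` and the formula holds
    (∀ (δ : Ordinal.{u}) (m : ℕ), Order.IsSuccPrelimit δ → maximalOrderType Q = δ + m →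
      k ≤ m ∧
      maximalOrderType (LexProduct P Q) =
        maximalOrderType P * (δ + ((m - k : ℕ) : Ordinal.{u})) +
          hessenbergMul (maximalOrderType P) (k : Ordinal.{u})) ∧
    -- the special case of no maximal elements
    (k = 0 ↔ Order.IsSuccPrelimit (maximalOrderType Q)) ∧
    (k = 0 →
      maximalOrderType (LexProduct P Q) = maximalOrderType P * maximalOrderType Q) := by
  have hsum := stature_not_isMax_add Q
  have hprod := stature_lexProduct P Q
  simp only [maximalOrderType_eq_stature]
  rw [hk] at hsum hprod
  refine ⟨isGreatest_stature_univ P, isGreatest_stature_univ Q, isGreatest_stature_univ _,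
    exists_isSuccPrelimit_add_natCast _, fun δ m hδ hm => ?_, ⟨fun hk0 => ?_, fun h => ?_⟩,
    fun hk0 => ?_⟩
  · rw [← hsum] at hm
    have hkm : k ≤ m := by
      by_contra! hlt
      obtain ⟨j, rfl⟩ := Nat.exists_eq_add_of_lt hlt
      -- If k = m + j + 1, cancelling m on the right of o(N) + k = δ + m would make δ a successor.
      have hj : stature {q : Q | ¬ IsMax q} + ((j + 1 : ℕ) : Ordinal.{u}) = δ := by
        refine (Ordinal.add_right_cancel m).1 (Eq.trans ?_ hm)
        rw [add_assoc, ← Nat.cast_add]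
        congr 2
        omega
      exact not_isSuccPrelimit_add_natCast _ (Nat.succ_ne_zero j) (hj ▸ hδ)
    refine ⟨hkm, ?_⟩
    have hε : stature {q : Q | ¬ IsMax q} = δ + ((m - k : ℕ) : Ordinal.{u}) := by
      refine (Ordinal.add_right_cancel k).1 (hm.trans ?_)
      rw [add_assoc, ← Nat.cast_add, Nat.sub_add_cancel hkm]
    rw [hprod, hε]
  · refine isSuccPrelimit_stature fun q hq => ?_
    have hempty := (Set.ncard_eq_zero (finite_setOf_isMax Q)).1 (hk.trans hk0)
    exact (hempty ▸ hq : q ∈ (∅ : Set Q))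
  · by_contra hk0
    exact not_isSuccPrelimit_add_natCast _ hk0 (hsum ▸ h)
  · subst hk0
    rw [hprod, ← hsum]
    simp [hessenbergMul_zero_right]
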